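/- For finite graphs $G$ and $H$ let $I(H,G)$ be the number of induced subgraphs of $G$ isomorphic to $H$ and let $p(H,G)=I(H,G)/\binom{|V(G)|}{|V(H)|}$. For $e\in[0,1]$ let $$I_H(e)=\limsup_{n\to\infty}\max\{p(H,G): G \text{ an } n\text{-vertex graph with } p(K_2,G)=e+o(1)\},$$ that is, the supremum of $\limsup_{n\to\infty}p(H,G_n)$ over all sequences $(G_n)$ of $n$-vertex graphs with $\lim_{n\to\infty} p(K_2,G_n)=e$. Let $K_{2,2,1}$ be the complete $3$-partite graph with class sizes $2,2,1$. Then $$I_{K_{2,2,1}}(0.74)\le \frac{44.94}{128},$$ and this bound is strictly smaller than $I_{K_{2,2,1}}(3/4)$, which equals $\frac{45}{128}$. -/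

import Mathlib

open Filter Topology

/-- `inducedCount H G` is the number of induced subgraphs of `G` isomorphic to `H`, that is, the
number of vertex sets `s` of `G` such that `G[s]` is isomorphic to `H`. -/
noncomputable def inducedCount {W V : Type*} [Fintype V]
    (H : SimpleGraph W) (G : SimpleGraph V) : ℕ :=
  {s : Set V | Nonempty (G.induce s ≃g H)}.ncard

/-- The density `p(H, G)`: the number of induced copies of `H` in `G` divided by
`|V(G)|` choose `|V(H)|` (it is `0` when `G` has fewer vertices than `H`). -/
noncomputable def inducedDensity {W V : Type*} [Fintype W] [Fintype V]
    (H : SimpleGraph W) (G : SimpleGraph V) : ℝ :=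
  (inducedCount H G : ℝ) / ((Fintype.card V).choose (Fintype.card W) : ℝ)

/-- The sequence `G 0, G 1, …`, where `G n` has `n` vertices, has edge density `e + o(1)`. -/
def HasEdgeDensityLimit (G : ∀ n : ℕ, SimpleGraph (Fin n)) (e : ℝ) : Prop :=
  Tendsto (fun n => inducedDensity (⊤ : SimpleGraph (Fin 2)) (G n)) atTop (𝓝 e)

/-- `I_H(e)`: the limsup, as `n → ∞`, of the maximum of `p(H, G)` over `n`-vertex graphs `G` with
`p(K₂, G) = e + o(1)`; that is, the supremum of `limsup p(H, G n)` over all sequences of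
`n`-vertex graphs `G n` with edge density `e + o(1)`. -/
noncomputable def maxInducedDensity {W : Type*} [Fintype W] (H : SimpleGraph W) (e : ℝ) : ℝ :=
  sSup {y : ℝ | ∃ G : ∀ n : ℕ, SimpleGraph (Fin n), HasEdgeDensityLimit G e ∧
    y = limsup (fun n => inducedDensity H (G n)) atTop}

/-- `K_{2,2,1}`, the complete `3`-partite graph with class sizes `2`, `2`, `1`. -/
abbrev K221 : SimpleGraph (Σ i : Fin 3, Fin (![2, 2, 1] i)) :=
  SimpleGraph.completeMultipartiteGraph fun i : Fin 3 => Fin (![2, 2, 1] i)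

/-! Both upper bounds are flag algebra arguments turned into exact integer inequalities. A weighted
sum of labelled copies of the target graph, squares of rooted flag sums and a term in the edge
density is bounded on every graph on six (density 0.74) or five (density 3/4) vertices by a finite
check. Averaging over all tuples of vertices of `G` and dropping the nonnegative squares bounds
`wheelCount`. Tuples may repeat vertices, so for a fixed root the sum over two flags factors into a
perfect square with no error term.

At 0.74 the edge constraint enters with a multiplier depending on the other four vertices; its total
is proportional to the deviation of the edge density from 0.74, so it vanishes in the limit
(`wheelCount_le_of_dartCount`). At 3/4 the edge term is linear (`wheelCount_add_dartCount_le`), and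
the squares are chosen to vanish on the balanced complete 4-partite graph, so the bound is sharp:
Turán graphs attain 45/128. As 44.94 < 45, the two values are separated. -/

/-! ### Finite certificates on six and five vertices -/

/-- Indicator, on ten adjacencies, that `c` is joined to all of `l₁, l₂, x, y`, and these four
vertices span the 4-cycle with non-edges `l₁l₂` and `xy`. -/
def wheelBool (cl₁ cl₂ cx cy l₁l₂ l₁x l₁y l₂x l₂y xy : Bool) : Bool :=
  cl₁ && cl₂ && cx && cy && l₁x && l₁y && l₂x && l₂y && !l₁l₂ && !xy

/-- Multiplier of the edge constraint attached to the graph on four vertices. -/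
def multiplier (ab ac ad bc bd cd : Bool) : ℤ :=
  let m := ab.toNat + ac.toNat + ad.toNat + bc.toNat + bd.toNat + cd.toNat
  let k := (ab && cd).toNat + (ac && bd).toNat + (ad && bc).toNat
  -- The number `m` of edges and the number `k` of pairs of disjoint edges determine the isomorphism
  -- type, except that the triangle and the star share `(3, 0)`.
  match m, k with
  | 0, _ => -47
  | 1, _ => 23
  | 2, 0 => 23
  | 2, _ => 181
  | 3, 0 => if (ab && bc && ac) || (ab && bd && ad) || (ac && cd && ad) || (bc && cd && bd)
      then -41 else 283
  | 3, _ => 181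
  | 4, 2 => 22
  | 4, _ => -41
  | 5, _ => -93
  | _, _ => -170

/-- The first of three functions on graphs rooted at an edge `uv` whose squares are used at density
`0.74`; the arguments are the adjacencies `uy, vy, uz, vz, yz`. -/
def edgeFlagW : Bool → Bool → Bool → Bool → Bool → ℤ
  | true, false, false, true, true => 11
  | false, true, true, false, true => 11
  | true, true, true, true, true => 4
  | true, true, true, true, false => -4
  | true, true, true, false, true => -3
  | true, true, false, true, true => -3
  | true, false, true, true, true => -3
  | false, true, true, true, true => -3
  | _, _, _, _, _ => 0

/-- The second function on graphs rooted at an edge, with the arguments of `edgeFlagW`. -/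
def edgeFlagO : Bool → Bool → Bool → Bool → Bool → ℤ
  | true, false, true, false, false => 8
  | false, true, false, true, false => -8
  | true, true, true, false, true => -1
  | true, false, true, true, true => -1
  | true, true, false, true, true => 1
  | false, true, true, true, true => 1
  | _, _, _, _, _ => 0

/-- The third function on graphs rooted at an edge, with the arguments of `edgeFlagW`. -/
def edgeFlagT : Bool → Bool → Bool → Bool → Bool → ℤ
  | true, true, true, false, true => 1
  | true, false, true, true, true => 1
  | true, true, false, true, true => -1
  | false, true, true, true, true => -1
  | _, _, _, _, _ => 0

/-- Contribution of the pairing `cd | ef` at the root `ab`. -/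
def pairingBool (ab ac ad ae af bc bd be bf cd ce cf de df ef : Bool) : ℤ :=
  (bif ab then 2 * (459 * (edgeFlagW ac bc ad bd cd * edgeFlagW ae be af bf ef)
      + 838 * (edgeFlagO ac bc ad bd cd * edgeFlagO ae be af bf ef)
      + 1131 * (edgeFlagT ac bc ad bd cd * edgeFlagT ae be af bf ef)) else 0)
  + 150000 * ((bif wheelBool ac ad ae af cd ce cf de df ef then 1 else 0)
      + (bif wheelBool bc bd be bf cd ce cf de df ef then 1 else 0))

/-- Contribution of the root `ab` in a graph on six vertices. -/
def rootBool (ab ac ad ae af bc bd be bf cd ce cf de df ef : Bool) : ℤ :=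
  -- The weights 13 and -37 average to zero at edge density 37/50 = 0.74.
  12 * multiplier cd ce cf de df ef * (bif ab then 13 else -37)
  + (pairingBool ab ac ad ae af bc bd be bf cd ce cf de df ef
  + pairingBool ab ac ae ad af bc be bd bf ce cd cf de ef df
  + pairingBool ab ac af ad ae bc bf bd be cf cd ce df ef de)

/-- Sum of the contributions of the fifteen roots in a graph on six vertices. -/
def sixBool (b01 b02 b12 b03 b13 b23 b04 b14 b24 b34 b05 b15 b25 b35 b45 : Bool) : ℤ :=
  rootBool b01 b02 b03 b04 b05 b12 b13 b14 b15 b23 b24 b25 b34 b35 b45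
  + rootBool b02 b01 b03 b04 b05 b12 b23 b24 b25 b13 b14 b15 b34 b35 b45
  + rootBool b03 b01 b02 b04 b05 b13 b23 b34 b35 b12 b14 b15 b24 b25 b45
  + rootBool b04 b01 b02 b03 b05 b14 b24 b34 b45 b12 b13 b15 b23 b25 b35
  + rootBool b05 b01 b02 b03 b04 b15 b25 b35 b45 b12 b13 b14 b23 b24 b34
  + rootBool b12 b01 b13 b14 b15 b02 b23 b24 b25 b03 b04 b05 b34 b35 b45
  + rootBool b13 b01 b12 b14 b15 b03 b23 b34 b35 b02 b04 b05 b24 b25 b45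
  + rootBool b14 b01 b12 b13 b15 b04 b24 b34 b45 b02 b03 b05 b23 b25 b35
  + rootBool b15 b01 b12 b13 b14 b05 b25 b35 b45 b02 b03 b04 b23 b24 b34
  + rootBool b23 b02 b12 b24 b25 b03 b13 b34 b35 b01 b04 b05 b14 b15 b45
  + rootBool b24 b02 b12 b23 b25 b04 b14 b34 b45 b01 b03 b05 b13 b15 b35
  + rootBool b25 b02 b12 b23 b24 b05 b15 b35 b45 b01 b03 b04 b13 b14 b34
  + rootBool b34 b03 b13 b23 b35 b04 b14 b24 b45 b01 b02 b05 b12 b15 b25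
  + rootBool b35 b03 b13 b23 b34 b05 b15 b25 b45 b01 b02 b04 b12 b14 b24
  + rootBool b45 b04 b14 b24 b34 b05 b15 b25 b35 b01 b02 b03 b12 b13 b23

/-- Conjunction over both Boolean values. -/
def bothBool (f : Bool → Bool) : Bool := f false && f true

theorem bothBool_eq_true {f : Bool → Bool} (h : bothBool f = true) (b : Bool) : f b = true := by
  have := Bool.and_eq_true_iff.mp h
  cases b
  exacts [this.1, this.2]

/-- Number of `true` entries. -/
def count₅ (a b c d e : Bool) : ℕ := a.toNat + b.toNat + c.toNat + d.toNat + e.toNat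

/-- The inequality `sixBool ≤ 315984` for all graphs whose degree sequence is monotone. -/
def sixCheck : Bool :=
  bothBool fun b01 => bothBool fun b02 => bothBool fun b03 => bothBool fun b04 =>
  bothBool fun b05 => bothBool fun b12 => bothBool fun b13 => bothBool fun b14 =>
  bothBool fun b15 =>
    -- Adjacencies are enumerated vertex by vertex, so that each degree comparison prunes a branch
    -- as soon as both degrees are known.
    !(Nat.ble (count₅ b01 b02 b03 b04 b05) (count₅ b01 b12 b13 b14 b15)) ||
  bothBool fun b23 => bothBool fun b24 => bothBool fun b25 =>
    !(Nat.ble (count₅ b01 b12 b13 b14 b15) (count₅ b02 b12 b23 b24 b25)) ||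
  bothBool fun b34 => bothBool fun b35 =>
    !(Nat.ble (count₅ b02 b12 b23 b24 b25) (count₅ b03 b13 b23 b34 b35)) ||
  bothBool fun b45 =>
    !(Nat.ble (count₅ b03 b13 b23 b34 b35) (count₅ b04 b14 b24 b34 b45) &&
      Nat.ble (count₅ b04 b14 b24 b34 b45) (count₅ b05 b15 b25 b35 b45)) ||
    decide (sixBool b01 b02 b12 b03 b13 b23 b04 b14 b24 b34 b05 b15 b25 b35 b45 ≤ 315984)

theorem sixCheck_eq_true : sixCheck = true := by decide +kernel

/-- The function on flags rooted at a cherry whose square is used at density `3/4`; the arguments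
are the adjacencies of a vertex to the centre and to the two leaves. -/
def cherryFlag : Bool → Bool → Bool → ℤ
  -- In the balanced complete 4-partite graph the leaves of a cherry share a class; a quarter of the
  -- vertices see only the centre, half see all three and a quarter see only the leaves, so these
  -- weights average to zero.
  | true, false, false => 1
  | true, true, true => 1
  | false, true, true => -3
  | _, _, _ => 0

/-- Contribution of the centre `c`, the leaves `l, m` and the further vertices `x, y`. -/
def cherryBool (cl cm cx cy lm lx ly mx my xy : Bool) : ℤ :=
  1920 * (bif wheelBool cl cm cx cy lm lx ly mx my xy then 1 else 0)
  + 120 * (bif xy then 1 else 0)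
  -- The weights 1 and -3 cancel exactly when the degree of `c` is three quarters of the order.
  + 15 * ((bif cx then 1 else -3) * (bif cy then 1 else -3))
  + 240 * (bif cl && cm && !lm then cherryFlag cx lx mx * cherryFlag cy ly my else 0)

/-- Sum of the contributions of the six choices of leaves at a given centre. -/
def centreBool (ca cb cd ce ab ad ae bd be de : Bool) : ℤ :=
  cherryBool ca cb cd ce ab ad ae bd be de + cherryBool ca cd cb ce ad ab ae bd de be
  + cherryBool ca ce cb cd ae ab ad be de bd + cherryBool cb cd ca ce bd ab be ad de ae
  + cherryBool cb ce ca cd be ab bd ae de ad + cherryBool cd ce ca cb de ad bd ae be ab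

/-- Sum of the contributions of the five centres in a graph on five vertices. -/
def fiveBool (b01 b02 b12 b03 b13 b23 b04 b14 b24 b34 : Bool) : ℤ :=
  centreBool b01 b02 b03 b04 b12 b13 b14 b23 b24 b34
  + centreBool b01 b12 b13 b14 b02 b03 b04 b23 b24 b34
  + centreBool b02 b12 b23 b24 b01 b03 b04 b13 b14 b34
  + centreBool b03 b13 b23 b34 b01 b02 b04 b12 b14 b24
  + centreBool b04 b14 b24 b34 b01 b02 b03 b12 b13 b23

/-- The inequality `fiveBool ≤ 4050` for all graphs on five vertices. -/
def fiveCheck : Bool :=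
  bothBool fun b01 => bothBool fun b02 => bothBool fun b12 => bothBool fun b03 =>
  bothBool fun b13 => bothBool fun b23 => bothBool fun b04 => bothBool fun b14 =>
  bothBool fun b24 => bothBool fun b34 =>
    decide (fiveBool b01 b02 b12 b03 b13 b23 b04 b14 b24 b34 ≤ 4050)

theorem fiveCheck_eq_true : fiveCheck = true := by decide +kernel

theorem fiveBool_le (b01 b02 b12 b03 b13 b23 b04 b14 b24 b34 : Bool) :
    fiveBool b01 b02 b12 b03 b13 b23 b04 b14 b24 b34 ≤ 4050 :=
  of_decide_eq_true <| bothBool_eq_true (bothBool_eq_true (bothBool_eq_true (bothBool_eq_true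
    (bothBool_eq_true (bothBool_eq_true (bothBool_eq_true (bothBool_eq_true (bothBool_eq_true
    (bothBool_eq_true fiveCheck_eq_true b01) b02) b12) b03) b13) b23) b04) b14) b24) b34

theorem sixBool_le_of_monotone {b01 b02 b12 b03 b13 b23 b04 b14 b24 b34 b05 b15 b25 b35 b45 : Bool}
    (h01 : count₅ b01 b02 b03 b04 b05 ≤ count₅ b01 b12 b13 b14 b15)
    (h12 : count₅ b01 b12 b13 b14 b15 ≤ count₅ b02 b12 b23 b24 b25)
    (h23 : count₅ b02 b12 b23 b24 b25 ≤ count₅ b03 b13 b23 b34 b35)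
    (h34 : count₅ b03 b13 b23 b34 b35 ≤ count₅ b04 b14 b24 b34 b45)
    (h45 : count₅ b04 b14 b24 b34 b45 ≤ count₅ b05 b15 b25 b35 b45) :
    sixBool b01 b02 b12 b03 b13 b23 b04 b14 b24 b34 b05 b15 b25 b35 b45 ≤ 315984 := by
  have h := bothBool_eq_true (bothBool_eq_true (bothBool_eq_true (bothBool_eq_true
    (bothBool_eq_true (bothBool_eq_true (bothBool_eq_true (bothBool_eq_true (bothBool_eq_true
    sixCheck_eq_true b01) b02) b03) b04) b05) b12) b13) b14) b15
  rw [Nat.ble_eq_true_of_le h01, Bool.not_true, Bool.false_or] at h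
  replace h := bothBool_eq_true (bothBool_eq_true (bothBool_eq_true h b23) b24) b25
  rw [Nat.ble_eq_true_of_le h12, Bool.not_true, Bool.false_or] at h
  replace h := bothBool_eq_true (bothBool_eq_true h b34) b35
  rw [Nat.ble_eq_true_of_le h23, Bool.not_true, Bool.false_or] at h
  replace h := bothBool_eq_true h b45
  rw [Nat.ble_eq_true_of_le h34, Nat.ble_eq_true_of_le h45, Bool.and_true, Bool.not_true,
    Bool.false_or] at h
  exact of_decide_eq_true h

/-! ### Invariance of the six-vertex sum under relabelling -/

section Symmetrization

variable {V : Type*} (A : V → V → Bool)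

/-- `rootBool` at a sequence of vertices. -/
def rootValue (a b c d e f : V) : ℤ :=
  rootBool (A a b) (A a c) (A a d) (A a e) (A a f) (A b c) (A b d) (A b e) (A b f)
    (A c d) (A c e) (A c f) (A d e) (A d f) (A e f)

/-- `sixBool` at a sequence of vertices. -/
def sixValue (x : Fin 6 → V) : ℤ :=
  sixBool (A (x 0) (x 1)) (A (x 0) (x 2)) (A (x 1) (x 2)) (A (x 0) (x 3)) (A (x 1) (x 3))
    (A (x 2) (x 3)) (A (x 0) (x 4)) (A (x 1) (x 4)) (A (x 2) (x 4)) (A (x 3) (x 4))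
    (A (x 0) (x 5)) (A (x 1) (x 5)) (A (x 2) (x 5)) (A (x 3) (x 5)) (A (x 4) (x 5))

/-- `pairingBool` at a sequence of vertices. -/
def pairingValue (a b c d e f : V) : ℤ :=
  pairingBool (A a b) (A a c) (A a d) (A a e) (A a f) (A b c) (A b d) (A b e) (A b f)
    (A c d) (A c e) (A c f) (A d e) (A d f) (A e f)

/-- `cherryBool` at a sequence of vertices. -/
def cherryValue (c l m x y : V) : ℤ :=
  cherryBool (A c l) (A c m) (A c x) (A c y) (A l m) (A l x) (A l y) (A m x) (A m y) (A x y)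

end Symmetrization

theorem edgeFlagW_swap_root : ∀ p q r s t, edgeFlagW q p s r t = edgeFlagW p q r s t := by
  decide

/-- The sign is harmless: only products of two values at the same root occur. -/
theorem edgeFlagO_swap_root : ∀ p q r s t, edgeFlagO q p s r t = -edgeFlagO p q r s t := by
  decide

theorem edgeFlagT_swap_root : ∀ p q r s t, edgeFlagT q p s r t = -edgeFlagT p q r s t := by
  decide

theorem edgeFlagW_swap : ∀ p q r s t, edgeFlagW r s p q t = edgeFlagW p q r s t := by
  decide

theorem edgeFlagO_swap : ∀ p q r s t, edgeFlagO r s p q t = edgeFlagO p q r s t := by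
  decide

theorem edgeFlagT_swap : ∀ p q r s t, edgeFlagT r s p q t = edgeFlagT p q r s t := by
  decide

theorem multiplier_swap₁₂ : ∀ ab ac ad bc bd cd,
    multiplier ab bc bd ac ad cd = multiplier ab ac ad bc bd cd := by
  decide

theorem multiplier_swap₂₃ : ∀ ab ac ad bc bd cd,
    multiplier ac ab ad bc cd bd = multiplier ab ac ad bc bd cd := by
  decide

theorem multiplier_swap₃₄ : ∀ ab ac ad bc bd cd,
    multiplier ab ad ac bd bc cd = multiplier ab ac ad bc bd cd := by
  decide

section Symmetrization

variable {V : Type*} {A : V → V → Bool}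

theorem pairingValue_swap_root (hA : ∀ u v, A u v = A v u) (a b c d e f : V) :
    pairingValue A b a c d e f = pairingValue A a b c d e f := by
  simp only [pairingValue, pairingBool, hA b a]
  rw [edgeFlagW_swap_root (A a c), edgeFlagW_swap_root (A a e), edgeFlagO_swap_root (A a c),
    edgeFlagO_swap_root (A a e), edgeFlagT_swap_root (A a c), edgeFlagT_swap_root (A a e),
    add_comm (bif wheelBool (A b c) _ _ _ _ _ _ _ _ _ then (1 : ℤ) else 0), neg_mul_neg,
    neg_mul_neg]

theorem pairingValue_swap_left (hA : ∀ u v, A u v = A v u) (a b c d e f : V) :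
    pairingValue A a b d c e f = pairingValue A a b c d e f := by
  simp only [pairingValue, pairingBool, hA d c]
  rw [edgeFlagW_swap, edgeFlagO_swap, edgeFlagT_swap]
  congr 4 <;> (simp only [wheelBool]; ac_rfl)

theorem pairingValue_swap_pairs (hA : ∀ u v, A u v = A v u) (a b c d e f : V) :
    pairingValue A a b e f c d = pairingValue A a b c d e f := by
  simp only [pairingValue, pairingBool, hA e c, hA e d, hA f c, hA f d]
  rw [mul_comm (edgeFlagW (A a e) _ _ _ _), mul_comm (edgeFlagO (A a e) _ _ _ _),
    mul_comm (edgeFlagT (A a e) _ _ _ _)]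
  congr 4 <;> (simp only [wheelBool]; ac_rfl)

theorem pairingValue_swap_right (hA : ∀ u v, A u v = A v u) (a b c d e f : V) :
    pairingValue A a b c d f e = pairingValue A a b c d e f := by
  rw [pairingValue_swap_pairs hA, pairingValue_swap_left hA, pairingValue_swap_pairs hA]

theorem rootValue_eq (hA : ∀ u v, A u v = A v u) (a b c d e f : V) :
    rootValue A a b c d e f =
      12 * multiplier (A c d) (A c e) (A c f) (A d e) (A d f) (A e f) *
        (bif A a b then 13 else -37) +
      (pairingValue A a b c d e f + pairingValue A a b c e d f + pairingValue A a b c f d e) := by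
  simp only [rootValue, rootBool, pairingValue, hA e d, hA f d, hA f e]

theorem rootValue_swap_root (hA : ∀ u v, A u v = A v u) (a b c d e f : V) :
    rootValue A b a c d e f = rootValue A a b c d e f := by
  simp only [rootValue_eq hA, hA b a, pairingValue_swap_root hA a b]

theorem rootValue_swap₁₂ (hA : ∀ u v, A u v = A v u) (a b c d e f : V) :
    rootValue A a b d c e f = rootValue A a b c d e f := by
  rw [rootValue_eq hA, rootValue_eq hA, hA d c, multiplier_swap₁₂, pairingValue_swap_left hA,
    ← pairingValue_swap_pairs hA a b d e c f, ← pairingValue_swap_pairs hA a b d f c e]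
  ring

theorem rootValue_swap₂₃ (hA : ∀ u v, A u v = A v u) (a b c d e f : V) :
    rootValue A a b c e d f = rootValue A a b c d e f := by
  rw [rootValue_eq hA, rootValue_eq hA, hA e d, multiplier_swap₂₃,
    pairingValue_swap_right hA a b c f d e]
  ring

theorem rootValue_swap₃₄ (hA : ∀ u v, A u v = A v u) (a b c d e f : V) :
    rootValue A a b c d f e = rootValue A a b c d e f := by
  rw [rootValue_eq hA, rootValue_eq hA, hA f e, multiplier_swap₃₄,
    pairingValue_swap_right hA a b c d e f]
  ring

theorem sixValue_eq (hA : ∀ u v, A u v = A v u) (x : Fin 6 → V) :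
    sixValue A x =
      rootValue A (x 0) (x 1) (x 2) (x 3) (x 4) (x 5)
      + rootValue A (x 0) (x 2) (x 1) (x 3) (x 4) (x 5)
      + rootValue A (x 0) (x 3) (x 1) (x 2) (x 4) (x 5)
      + rootValue A (x 0) (x 4) (x 1) (x 2) (x 3) (x 5)
      + rootValue A (x 0) (x 5) (x 1) (x 2) (x 3) (x 4)
      + rootValue A (x 1) (x 2) (x 0) (x 3) (x 4) (x 5)
      + rootValue A (x 1) (x 3) (x 0) (x 2) (x 4) (x 5)
      + rootValue A (x 1) (x 4) (x 0) (x 2) (x 3) (x 5)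
      + rootValue A (x 1) (x 5) (x 0) (x 2) (x 3) (x 4)
      + rootValue A (x 2) (x 3) (x 0) (x 1) (x 4) (x 5)
      + rootValue A (x 2) (x 4) (x 0) (x 1) (x 3) (x 5)
      + rootValue A (x 2) (x 5) (x 0) (x 1) (x 3) (x 4)
      + rootValue A (x 3) (x 4) (x 0) (x 1) (x 2) (x 5)
      + rootValue A (x 3) (x 5) (x 0) (x 1) (x 2) (x 4)
      + rootValue A (x 4) (x 5) (x 0) (x 1) (x 2) (x 3) := by
  simp only [sixValue, sixBool, rootValue, hA (x 1) (x 0), hA (x 2) (x 0), hA (x 3) (x 0),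
    hA (x 4) (x 0), hA (x 5) (x 0), hA (x 2) (x 1), hA (x 3) (x 1), hA (x 4) (x 1), hA (x 5) (x 1),
    hA (x 3) (x 2), hA (x 4) (x 2), hA (x 5) (x 2), hA (x 4) (x 3), hA (x 5) (x 3), hA (x 5) (x 4)]

/-- The four non-root vertices are always listed in increasing order. Exchanging two consecutive
labels therefore permutes the fifteen terms, up to swapping the two root vertices or two neighbours
in that list. -/
theorem sixValue_comp_swap (hA : ∀ u v, A u v = A v u) (i : Fin 5) (x : Fin 6 → V) :
    sixValue A (x ∘ Equiv.swap i.castSucc i.succ) = sixValue A x := by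
  have h1 := rootValue_swap_root hA (x i.castSucc) (x i.succ)
  have h2 := fun a b => rootValue_swap₁₂ hA a b (x i.castSucc) (x i.succ)
  have h3 := fun a b c => rootValue_swap₂₃ hA a b c (x i.castSucc) (x i.succ)
  have h4 := fun a b c d => rootValue_swap₃₄ hA a b c d (x i.castSucc) (x i.succ)
  rw [sixValue_eq hA, sixValue_eq hA]
  fin_cases i <;>
  · simp [Equiv.swap_apply_def] at h1 h2 h3 h4 ⊢
    simp only [h1, h2, h3, h4]
    ring

end Symmetrization

/-! ### Sums over tuples of vertices -/

section Sums

variable {V : Type*}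

theorem sum_comp_of_injective [Fintype V] [DecidableEq V] {n : ℕ} (F : (Fin n → V) → ℤ)
    {t : Fin n → Fin n} (ht : Function.Injective t) :
    ∑ x : Fin n → V, F (fun i => x (t i)) = ∑ x : Fin n → V, F x :=
  Equiv.sum_comp ((Equiv.ofBijective t ht.bijective_of_finite).symm.arrowCongr (Equiv.refl V)) F

theorem sum_fin_succ_fun [Fintype V] [DecidableEq V] {n : ℕ} (F : (Fin (n + 1) → V) → ℤ) :
    ∑ x : Fin (n + 1) → V, F x = ∑ a, ∑ x : Fin n → V, F (Fin.cons a x) := by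
  rw [← (Fin.consEquiv fun _ => V).sum_comp, Fintype.sum_prod_type]
  rfl

theorem sum_fin_five_fun [Fintype V] [DecidableEq V] (g : V → V → V → V → V → ℤ) :
    ∑ x : Fin 5 → V, g (x 0) (x 1) (x 2) (x 3) (x 4) =
      ∑ a, ∑ b, ∑ c, ∑ d, ∑ e, g a b c d e := by
  simp only [sum_fin_succ_fun, Fintype.sum_unique]
  rfl

theorem sum_fin_six_fun [Fintype V] [DecidableEq V] (g : V → V → V → V → V → V → ℤ) :
    ∑ x : Fin 6 → V, g (x 0) (x 1) (x 2) (x 3) (x 4) (x 5) =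
      ∑ a, ∑ b, ∑ c, ∑ d, ∑ e, ∑ f, g a b c d e f := by
  simp only [sum_fin_succ_fun, Fintype.sum_unique]
  rfl

end Sums

/-! ### The inequality at edge density 0.74 -/

section Six

variable {V : Type*} {A : V → V → Bool}

theorem sixValue_comp_perm (hA : ∀ u v, A u v = A v u) (σ : Equiv.Perm (Fin 6)) :
    ∀ x : Fin 6 → V, sixValue A (x ∘ σ) = sixValue A x := by
  have hσ : σ ∈ Submonoid.closure (Set.range fun i : Fin 5 => Equiv.swap i.castSucc i.succ) := by
    rw [Equiv.Perm.mclosure_swap_castSucc_succ]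
    trivial
  induction hσ using Submonoid.closure_induction with
  | mem τ hτ =>
    obtain ⟨i, rfl⟩ := hτ
    exact sixValue_comp_swap hA i
  | one => exact fun x => rfl
  | mul τ ρ _ _ hτ hρ => exact fun x => (hρ (x ∘ τ)).trans (hτ x)

/-- By symmetry the tuple may be sorted by degree within itself, which is the case covered by the
finite check. Repeated vertices are harmless: they behave as non-adjacent twins. -/
theorem sixValue_le (hA : ∀ u v, A u v = A v u) (hA' : ∀ v, A v v = false) (x : Fin 6 → V) :
    sixValue A x ≤ 315984 := by
  set deg : Fin 6 → ℕ := fun i => ∑ j, (A (x i) (x j)).toNat with hdeg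
  set σ := Tuple.sort deg
  have hmono : Monotone (deg ∘ σ) := Tuple.monotone_sort deg
  rw [← sixValue_comp_perm hA σ]
  set y := x ∘ σ with hy
  have hd : ∀ i, (deg ∘ σ) i = ∑ j, (A (y i) (y j)).toNat := fun i =>
    (Equiv.sum_comp σ fun j => (A (y i) (x j)).toNat).symm
  have h0 : (deg ∘ σ) 0 = count₅ (A (y 0) (y 1)) (A (y 0) (y 2)) (A (y 0) (y 3)) (A (y 0) (y 4))
      (A (y 0) (y 5)) := by
    rw [hd, Fin.sum_univ_six, hA']; simp [count₅]
  have h1 : (deg ∘ σ) 1 = count₅ (A (y 0) (y 1)) (A (y 1) (y 2)) (A (y 1) (y 3)) (A (y 1) (y 4))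
      (A (y 1) (y 5)) := by
    rw [hd, Fin.sum_univ_six, hA', hA (y 1) (y 0)]; simp [count₅]
  have h2 : (deg ∘ σ) 2 = count₅ (A (y 0) (y 2)) (A (y 1) (y 2)) (A (y 2) (y 3)) (A (y 2) (y 4))
      (A (y 2) (y 5)) := by
    rw [hd, Fin.sum_univ_six, hA', hA (y 2) (y 0), hA (y 2) (y 1)]; simp [count₅]
  have h3 : (deg ∘ σ) 3 = count₅ (A (y 0) (y 3)) (A (y 1) (y 3)) (A (y 2) (y 3)) (A (y 3) (y 4))
      (A (y 3) (y 5)) := by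
    rw [hd, Fin.sum_univ_six, hA', hA (y 3) (y 0), hA (y 3) (y 1), hA (y 3) (y 2)]; simp [count₅]
  have h4 : (deg ∘ σ) 4 = count₅ (A (y 0) (y 4)) (A (y 1) (y 4)) (A (y 2) (y 4)) (A (y 3) (y 4))
      (A (y 4) (y 5)) := by
    rw [hd, Fin.sum_univ_six, hA', hA (y 4) (y 0), hA (y 4) (y 1), hA (y 4) (y 2), hA (y 4) (y 3)]
    simp [count₅]
  have h5 : (deg ∘ σ) 5 = count₅ (A (y 0) (y 5)) (A (y 1) (y 5)) (A (y 2) (y 5)) (A (y 3) (y 5))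
      (A (y 4) (y 5)) := by
    rw [hd, Fin.sum_univ_six, hA', hA (y 5) (y 0), hA (y 5) (y 1), hA (y 5) (y 2), hA (y 5) (y 3),
      hA (y 5) (y 4)]
    simp [count₅]
  have m01 := hmono (show (0 : Fin 6) ≤ 1 by decide)
  have m12 := hmono (show (1 : Fin 6) ≤ 2 by decide)
  have m23 := hmono (show (2 : Fin 6) ≤ 3 by decide)
  have m34 := hmono (show (3 : Fin 6) ≤ 4 by decide)
  have m45 := hmono (show (4 : Fin 6) ≤ 5 by decide)
  rw [h0, h1] at m01
  rw [h1, h2] at m12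
  rw [h2, h3] at m23
  rw [h3, h4] at m34
  rw [h4, h5] at m45
  exact sixBool_le_of_monotone m01 m12 m23 m34 m45

/-- Averaging: summed over all tuples, each of the fifteen terms of `sixValue` gives the same total.
-/
theorem sum_rootValue_le [Fintype V] [DecidableEq V] (hA : ∀ u v, A u v = A v u)
    (hA' : ∀ v, A v v = false) :
    15 * ∑ x : Fin 6 → V, rootValue A (x 0) (x 1) (x 2) (x 3) (x 4) (x 5) ≤
      315984 * (Fintype.card V : ℤ) ^ 6 := by
  have key : ∀ t : Fin 6 → Fin 6, Function.Injective t →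
      ∑ x : Fin 6 → V, rootValue A (x (t 0)) (x (t 1)) (x (t 2)) (x (t 3)) (x (t 4)) (x (t 5)) =
      ∑ x : Fin 6 → V, rootValue A (x 0) (x 1) (x 2) (x 3) (x 4) (x 5) := fun t ht =>
    sum_comp_of_injective (fun x => rootValue A (x 0) (x 1) (x 2) (x 3) (x 4) (x 5)) ht
  have h : ∑ x : Fin 6 → V, sixValue A x ≤ ∑ _x : Fin 6 → V, 315984 :=
    Finset.sum_le_sum fun x _ => sixValue_le hA hA' x
  simp only [sixValue_eq hA, Finset.sum_add_distrib, Finset.sum_const, Finset.card_univ,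
    Fintype.card_fun, Fintype.card_fin, nsmul_eq_mul, Nat.cast_pow] at h
  have h02 := key ![0, 2, 1, 3, 4, 5] (by decide)
  have h03 := key ![0, 3, 1, 2, 4, 5] (by decide)
  have h04 := key ![0, 4, 1, 2, 3, 5] (by decide)
  have h05 := key ![0, 5, 1, 2, 3, 4] (by decide)
  have h12 := key ![1, 2, 0, 3, 4, 5] (by decide)
  have h13 := key ![1, 3, 0, 2, 4, 5] (by decide)
  have h14 := key ![1, 4, 0, 2, 3, 5] (by decide)
  have h15 := key ![1, 5, 0, 2, 3, 4] (by decide)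
  have h23 := key ![2, 3, 0, 1, 4, 5] (by decide)
  have h24 := key ![2, 4, 0, 1, 3, 5] (by decide)
  have h25 := key ![2, 5, 0, 1, 3, 4] (by decide)
  have h34 := key ![3, 4, 0, 1, 2, 5] (by decide)
  have h35 := key ![3, 5, 0, 1, 2, 4] (by decide)
  have h45 := key ![4, 5, 0, 1, 2, 3] (by decide)
  simp only [Matrix.cons_val] at h02 h03 h04 h05 h12 h13 h14 h15 h23 h24 h25 h34 h35 h45
  rw [h02, h03, h04, h05, h12, h13, h14, h15, h23, h24, h25, h34, h35, h45] at h
  linarith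

theorem sum_mul_sum_nonneg {V : Type*} [Fintype V] (g : V → V → ℤ) :
    0 ≤ ∑ c, ∑ d, ∑ e, ∑ f, g c d * g e f := by
  have : ∑ c, ∑ d, ∑ e, ∑ f, g c d * g e f = (∑ c, ∑ d, g c d) ^ 2 := by
    simp only [← Finset.mul_sum, ← Finset.sum_mul, sq]
  rw [this]
  positivity

/-- The number of homomorphic labelled copies of `K₂,₂,₁` with universal vertex first. -/
def wheelCount {V : Type*} [Fintype V] (A : V → V → Bool) : ℤ :=
  ∑ a, ∑ c, ∑ d, ∑ e, ∑ f, (bif wheelBool (A a c) (A a d) (A a e) (A a f) (A c d) (A c e) (A c f)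
    (A d e) (A d f) (A e f) then 1 else 0)

/-- At a fixed root edge the flag products sum to squares and can be dropped. Each of the two wheel
terms leaves one root vertex free, whence the factor 2 · 150000 · |V|. -/
theorem le_sum_pairingValue {V : Type*} [Fintype V] (A : V → V → Bool) :
    300000 * Fintype.card V * wheelCount A ≤
      ∑ a, ∑ b, ∑ c, ∑ d, ∑ e, ∑ f, pairingValue A a b c d e f := by
  set w : V → V → V → V → V → ℤ := fun a c d e f =>
    bif wheelBool (A a c) (A a d) (A a e) (A a f) (A c d) (A c e) (A c f)
      (A d e) (A d f) (A e f) then 1 else 0 with hw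
  have h : ∀ a b, ∑ c, ∑ d, ∑ e, ∑ f, 150000 * (w a c d e f + w b c d e f) ≤
      ∑ c, ∑ d, ∑ e, ∑ f, pairingValue A a b c d e f := by
    intro a b
    simp only [pairingValue, pairingBool, Finset.sum_add_distrib]
    refine le_add_of_nonneg_left ?_
    cases A a b
    · simp
    · simp only [cond_true, Finset.sum_add_distrib, ← Finset.mul_sum]
      have h1 := sum_mul_sum_nonneg fun c d => edgeFlagW (A a c) (A b c) (A a d) (A b d) (A c d)
      have h2 := sum_mul_sum_nonneg fun c d => edgeFlagO (A a c) (A b c) (A a d) (A b d) (A c d)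
      have h3 := sum_mul_sum_nonneg fun c d => edgeFlagT (A a c) (A b c) (A a d) (A b d) (A c d)
      simp only [← Finset.mul_sum] at h1 h2 h3
      linarith
  refine le_trans (le_of_eq ?_) (Finset.sum_le_sum fun a _ => Finset.sum_le_sum fun b _ => h a b)
  simp only [← Finset.mul_sum, Finset.sum_add_distrib, Finset.sum_const, Finset.card_univ,
    nsmul_eq_mul, wheelCount]
  ring

/-- The number of ordered pairs of adjacent vertices. -/
def dartCount {V : Type*} [Fintype V] (A : V → V → Bool) : ℤ := ∑ a, ∑ b, (bif A a b then 1 else 0)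

theorem abs_multiplier_le : ∀ ab ac ad bc bd cd, |multiplier ab ac ad bc bd cd| ≤ 283 := by
  decide

/-- The constants are 13500000 = 15 · 3 · 300000 (roots, pairings, wheel weight) and 50940 = 15 · 12
· 283, with 283 the largest absolute value of the multiplier. -/
theorem wheelCount_le_of_dartCount [Fintype V] [DecidableEq V]
    (hA : ∀ u v, A u v = A v u) (hA' : ∀ v, A v v = false) :
    13500000 * Fintype.card V * wheelCount A ≤
      315984 * (Fintype.card V : ℤ) ^ 6 +
        50940 * (Fintype.card V : ℤ) ^ 4 * |50 * dartCount A - 37 * (Fintype.card V : ℤ) ^ 2| := by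
  have h := sum_rootValue_le hA hA'
  set n : ℤ := (Fintype.card V : ℤ)
  have hp := le_sum_pairingValue A
  rw [← sum_fin_six_fun fun a b c d e f => pairingValue A a b c d e f] at hp
  have key : ∀ t : Fin 6 → Fin 6, Function.Injective t →
      ∑ x : Fin 6 → V, pairingValue A (x (t 0)) (x (t 1)) (x (t 2)) (x (t 3)) (x (t 4)) (x (t 5)) =
      ∑ x : Fin 6 → V, pairingValue A (x 0) (x 1) (x 2) (x 3) (x 4) (x 5) := fun t ht =>
    sum_comp_of_injective (fun x => pairingValue A (x 0) (x 1) (x 2) (x 3) (x 4) (x 5)) ht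
  have k1 := key ![0, 1, 2, 4, 3, 5] (by decide)
  have k2 := key ![0, 1, 2, 5, 3, 4] (by decide)
  simp only [Matrix.cons_val] at k1 k2
  simp only [rootValue_eq hA, Finset.sum_add_distrib] at h
  rw [k1, k2] at h
  set m : ℤ := ∑ c, ∑ d, ∑ e, ∑ f,
    multiplier (A c d) (A c e) (A c f) (A d e) (A d f) (A e f) with hm
  have hm' : |m| ≤ 283 * n ^ 4 := by
    have h1 : ∀ c d e, |∑ f, multiplier (A c d) (A c e) (A c f) (A d e) (A d f) (A e f)| ≤
        283 * n := fun c d e => (Finset.abs_sum_le_sum_abs _ _).trans <|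
      (Finset.sum_le_card_nsmul _ _ 283 fun f _ => abs_multiplier_le _ _ _ _ _ _).trans
        (by simp [n, Finset.card_univ, mul_comm])
    have h2 : ∀ c d, |∑ e, ∑ f, multiplier (A c d) (A c e) (A c f) (A d e) (A d f) (A e f)| ≤
        283 * n ^ 2 := fun c d => (Finset.abs_sum_le_sum_abs _ _).trans <|
      (Finset.sum_le_card_nsmul _ _ _ fun e _ => h1 c d e).trans
        (by simp only [n, Finset.card_univ, nsmul_eq_mul]; apply le_of_eq; ring)
    have h3 : ∀ c, |∑ d, ∑ e, ∑ f, multiplier (A c d) (A c e) (A c f) (A d e) (A d f) (A e f)| ≤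
        283 * n ^ 3 := fun c => (Finset.abs_sum_le_sum_abs _ _).trans <|
      (Finset.sum_le_card_nsmul _ _ _ fun d _ => h2 c d).trans
        (by simp only [n, Finset.card_univ, nsmul_eq_mul]; apply le_of_eq; ring)
    exact (Finset.abs_sum_le_sum_abs _ _).trans <|
      (Finset.sum_le_card_nsmul _ _ _ fun c _ => h3 c).trans
        (by simp only [n, Finset.card_univ, nsmul_eq_mul]; apply le_of_eq; ring)
  have hs : ∑ x : Fin 6 → V, 12 * multiplier (A (x 2) (x 3)) (A (x 2) (x 4)) (A (x 2) (x 5))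
      (A (x 3) (x 4)) (A (x 3) (x 5)) (A (x 4) (x 5)) * (bif A (x 0) (x 1) then 13 else -37) =
      12 * m * (50 * dartCount A - 37 * n ^ 2) := by
    rw [sum_fin_six_fun fun a b c d e f => 12 * multiplier (A c d) (A c e) (A c f) (A d e) (A d f)
      (A e f) * (bif A a b then 13 else -37)]
    simp only [← Finset.sum_mul, ← Finset.mul_sum, ← hm]
    congr 1
    have : ∀ a b, (bif A a b then (13 : ℤ) else -37) = 50 * (bif A a b then 1 else 0) - 37 := by
      intro a b
      cases A a b <;> rfl
    simp only [this, Finset.sum_sub_distrib, ← Finset.mul_sum, Finset.sum_const, Finset.card_univ,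
      nsmul_eq_mul, dartCount]
    ring
  rw [hs] at h
  have hmul : -(m * (50 * dartCount A - 37 * n ^ 2)) ≤
      283 * n ^ 4 * |50 * dartCount A - 37 * n ^ 2| :=
    (neg_le_abs _).trans (by
      rw [abs_mul]
      exact mul_le_mul_of_nonneg_right hm' (abs_nonneg _))
  linarith

end Six

/-! ### The sharp inequality for edge density 3/4 -/

section Five

variable {V : Type*} {A : V → V → Bool}

theorem five_cherryValue_le (hA : ∀ u v, A u v = A v u) (x : Fin 5 → V) :
    cherryValue A (x 0) (x 1) (x 2) (x 3) (x 4)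
      + cherryValue A (x 0) (x 1) (x 3) (x 2) (x 4)
      + cherryValue A (x 0) (x 1) (x 4) (x 2) (x 3)
      + cherryValue A (x 0) (x 2) (x 3) (x 1) (x 4)
      + cherryValue A (x 0) (x 2) (x 4) (x 1) (x 3)
      + cherryValue A (x 0) (x 3) (x 4) (x 1) (x 2)
      + cherryValue A (x 1) (x 0) (x 2) (x 3) (x 4)
      + cherryValue A (x 1) (x 0) (x 3) (x 2) (x 4)
      + cherryValue A (x 1) (x 0) (x 4) (x 2) (x 3)
      + cherryValue A (x 1) (x 2) (x 3) (x 0) (x 4)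
      + cherryValue A (x 1) (x 2) (x 4) (x 0) (x 3)
      + cherryValue A (x 1) (x 3) (x 4) (x 0) (x 2)
      + cherryValue A (x 2) (x 0) (x 1) (x 3) (x 4)
      + cherryValue A (x 2) (x 0) (x 3) (x 1) (x 4)
      + cherryValue A (x 2) (x 0) (x 4) (x 1) (x 3)
      + cherryValue A (x 2) (x 1) (x 3) (x 0) (x 4)
      + cherryValue A (x 2) (x 1) (x 4) (x 0) (x 3)
      + cherryValue A (x 2) (x 3) (x 4) (x 0) (x 1)
      + cherryValue A (x 3) (x 0) (x 1) (x 2) (x 4)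
      + cherryValue A (x 3) (x 0) (x 2) (x 1) (x 4)
      + cherryValue A (x 3) (x 0) (x 4) (x 1) (x 2)
      + cherryValue A (x 3) (x 1) (x 2) (x 0) (x 4)
      + cherryValue A (x 3) (x 1) (x 4) (x 0) (x 2)
      + cherryValue A (x 3) (x 2) (x 4) (x 0) (x 1)
      + cherryValue A (x 4) (x 0) (x 1) (x 2) (x 3)
      + cherryValue A (x 4) (x 0) (x 2) (x 1) (x 3)
      + cherryValue A (x 4) (x 0) (x 3) (x 1) (x 2)
      + cherryValue A (x 4) (x 1) (x 2) (x 0) (x 3)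
      + cherryValue A (x 4) (x 1) (x 3) (x 0) (x 2)
      + cherryValue A (x 4) (x 2) (x 3) (x 0) (x 1) ≤ 4050 := by
  have h := fiveBool_le (A (x 0) (x 1)) (A (x 0) (x 2)) (A (x 1) (x 2)) (A (x 0) (x 3))
    (A (x 1) (x 3)) (A (x 2) (x 3)) (A (x 0) (x 4)) (A (x 1) (x 4)) (A (x 2) (x 4)) (A (x 3) (x 4))
  simp only [fiveBool, centreBool] at h
  simp only [cherryValue, hA (x 1) (x 0), hA (x 2) (x 0), hA (x 2) (x 1), hA (x 3) (x 0),
    hA (x 3) (x 1), hA (x 3) (x 2), hA (x 4) (x 0), hA (x 4) (x 1), hA (x 4) (x 2),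
    hA (x 4) (x 3)]
  linarith

/-- The thirty choices of a centre and two leaves have equal totals, and 4050 / 30 = 135. -/
theorem sum_cherryValue_le [Fintype V] [DecidableEq V] (hA : ∀ u v, A u v = A v u) :
    ∑ x : Fin 5 → V, cherryValue A (x 0) (x 1) (x 2) (x 3) (x 4) ≤
      135 * (Fintype.card V : ℤ) ^ 5 := by
  have key : ∀ t : Fin 5 → Fin 5, Function.Injective t →
      ∑ x : Fin 5 → V, cherryValue A (x (t 0)) (x (t 1)) (x (t 2)) (x (t 3)) (x (t 4)) =
      ∑ x : Fin 5 → V, cherryValue A (x 0) (x 1) (x 2) (x 3) (x 4) := fun t ht =>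
    sum_comp_of_injective (fun x => cherryValue A (x 0) (x 1) (x 2) (x 3) (x 4)) ht
  have h := Finset.sum_le_sum fun (x : Fin 5 → V) (_ : x ∈ Finset.univ) => five_cherryValue_le hA x
  simp only [Finset.sum_add_distrib, Finset.sum_const, Finset.card_univ,
    Fintype.card_fun, Fintype.card_fin, nsmul_eq_mul, Nat.cast_pow] at h
  have h1 := key ![0, 1, 3, 2, 4] (by decide)
  have h2 := key ![0, 1, 4, 2, 3] (by decide)
  have h3 := key ![0, 2, 3, 1, 4] (by decide)
  have h4 := key ![0, 2, 4, 1, 3] (by decide)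
  have h5 := key ![0, 3, 4, 1, 2] (by decide)
  have h6 := key ![1, 0, 2, 3, 4] (by decide)
  have h7 := key ![1, 0, 3, 2, 4] (by decide)
  have h8 := key ![1, 0, 4, 2, 3] (by decide)
  have h9 := key ![1, 2, 3, 0, 4] (by decide)
  have h10 := key ![1, 2, 4, 0, 3] (by decide)
  have h11 := key ![1, 3, 4, 0, 2] (by decide)
  have h12 := key ![2, 0, 1, 3, 4] (by decide)
  have h13 := key ![2, 0, 3, 1, 4] (by decide)
  have h14 := key ![2, 0, 4, 1, 3] (by decide)
  have h15 := key ![2, 1, 3, 0, 4] (by decide)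
  have h16 := key ![2, 1, 4, 0, 3] (by decide)
  have h17 := key ![2, 3, 4, 0, 1] (by decide)
  have h18 := key ![3, 0, 1, 2, 4] (by decide)
  have h19 := key ![3, 0, 2, 1, 4] (by decide)
  have h20 := key ![3, 0, 4, 1, 2] (by decide)
  have h21 := key ![3, 1, 2, 0, 4] (by decide)
  have h22 := key ![3, 1, 4, 0, 2] (by decide)
  have h23 := key ![3, 2, 4, 0, 1] (by decide)
  have h24 := key ![4, 0, 1, 2, 3] (by decide)
  have h25 := key ![4, 0, 2, 1, 3] (by decide)
  have h26 := key ![4, 0, 3, 1, 2] (by decide)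
  have h27 := key ![4, 1, 2, 0, 3] (by decide)
  have h28 := key ![4, 1, 3, 0, 2] (by decide)
  have h29 := key ![4, 2, 3, 0, 1] (by decide)
  simp only [Matrix.cons_val] at h1 h2 h3 h4 h5 h6 h7 h8 h9 h10 h11 h12 h13 h14 h15
  simp only [Matrix.cons_val] at h16 h17 h18 h19 h20 h21 h22 h23 h24 h25 h26 h27 h28 h29
  linarith

theorem wheelCount_add_dartCount_le [Fintype V] [DecidableEq V] (hA : ∀ u v, A u v = A v u) :
    1920 * wheelCount A + 120 * (Fintype.card V : ℤ) ^ 3 * dartCount A ≤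
      135 * (Fintype.card V : ℤ) ^ 5 := by
  refine le_trans ?_ (sum_cherryValue_le hA)
  rw [sum_fin_five_fun fun a b c d e => cherryValue A a b c d e]
  simp only [cherryValue, cherryBool, Finset.sum_add_distrib]
  have h1 : 0 ≤ ∑ c : V, ∑ _l : V, ∑ _m : V, ∑ x, ∑ y,
      15 * ((bif A c x then (1 : ℤ) else -3) * (bif A c y then 1 else -3)) := by
    refine Finset.sum_nonneg fun c _ => Finset.sum_nonneg fun l _ => Finset.sum_nonneg fun m _ => ?_
    simp only [← Finset.mul_sum, ← Finset.sum_mul]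
    exact mul_nonneg (by norm_num) (mul_self_nonneg _)
  have h2 : 0 ≤ ∑ c : V, ∑ l : V, ∑ m : V, ∑ x, ∑ y, 240 * (bif A c l && A c m && !A l m then
      cherryFlag (A c x) (A l x) (A m x) * cherryFlag (A c y) (A l y) (A m y) else 0) := by
    refine Finset.sum_nonneg fun c _ => Finset.sum_nonneg fun l _ => Finset.sum_nonneg fun m _ => ?_
    cases A c l && A c m && !A l m
    · simp
    · simp only [cond_true, ← Finset.mul_sum, ← Finset.sum_mul]
      exact mul_nonneg (by norm_num) (mul_self_nonneg _)
  have h3 : ∑ _c : V, ∑ _l : V, ∑ _m : V, ∑ x, ∑ y, 120 * (bif A x y then (1 : ℤ) else 0) =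
      120 * (Fintype.card V : ℤ) ^ 3 * dartCount A := by
    simp only [← Finset.mul_sum, Finset.sum_const, Finset.card_univ, nsmul_eq_mul, dartCount]
    ring
  have h4 : 1920 * wheelCount A = ∑ c : V, ∑ l : V, ∑ m : V, ∑ x, ∑ y,
      1920 * (bif wheelBool (A c l) (A c m) (A c x) (A c y) (A l m) (A l x) (A l y) (A m x) (A m y)
        (A x y) then (1 : ℤ) else 0) := by
    simp only [← Finset.mul_sum, wheelCount]
  linarith

end Five

/-! ### Induced copies, embeddings and automorphisms -/

section Counting

variable {W V : Type*}

/-- An embedding amounts to its range together with an isomorphism onto it; composing with one fixed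
isomorphism identifies the latter with automorphisms of `H`. -/
theorem card_embedding_eq [Fintype V] (H : SimpleGraph W) (G : SimpleGraph V) :
    Nat.card (H ↪g G) = inducedCount H G * Nat.card (H ≃g H) := by
  let S := {s : Set V | Nonempty (G.induce s ≃g H)}
  let Ψ : (Σ s : S, (H ≃g G.induce (s : Set V))) → (H ↪g G) := fun p =>
    (SimpleGraph.Embedding.induce (p.1 : Set V)).comp p.2.toEmbedding
  have hrange : ∀ p, Set.range (Ψ p) = (p.1 : Set V) := by
    rintro ⟨⟨s, hs⟩, e⟩
    ext v
    constructor
    · rintro ⟨w, rfl⟩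
      exact (e w).2
    · intro hv
      exact ⟨e.symm ⟨v, hv⟩, congrArg Subtype.val (e.apply_symm_apply ⟨v, hv⟩)⟩
  have hΨ : Function.Bijective Ψ := by
    constructor
    · rintro ⟨⟨s, hs⟩, e⟩ ⟨⟨t, ht⟩, e'⟩ h
      obtain rfl : s = t := by
        have h1 := hrange ⟨⟨s, hs⟩, e⟩
        rw [h, hrange] at h1
        exact h1.symm
      have : e = e' := by
        ext w
        exact congrArg (fun f : H ↪g G => f w) h
      rw [this]
    · intro f
      let e : H ≃g G.induce (Set.range f) :=
        { toEquiv := Equiv.ofInjective f f.injective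
          map_rel_iff' := fun {a b} => f.map_rel_iff }
      refine ⟨⟨⟨Set.range f, ⟨e.symm⟩⟩, e⟩, ?_⟩
      ext w
      rfl
  let Φ : (Σ s : S, (H ≃g G.induce (s : Set V))) ≃ S × (H ≃g H) :=
    (Equiv.sigmaCongrRight fun s : S =>
      { toFun := fun g => g.trans s.2.some
        invFun := fun g => g.trans s.2.some.symm
        left_inv := fun g => by ext; simp
        right_inv := fun g => by ext; simp }).trans (Equiv.sigmaEquivProd _ _)
  rw [← Nat.card_congr (Equiv.ofBijective Ψ hΨ), Nat.card_congr Φ, Nat.card_prod]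
  rfl

theorem inducedCount_congr {W' : Type*} [Fintype V] {H : SimpleGraph W} {H' : SimpleGraph W'}
    (e : H ≃g H') (G : SimpleGraph V) : inducedCount H G = inducedCount H' G := by
  unfold inducedCount
  congr 1
  ext s
  exact ⟨fun ⟨f⟩ => ⟨f.trans e⟩, fun ⟨f⟩ => ⟨f.trans e.symm⟩⟩

/-- `K₂,₂,₁` on `Fin 5`, with universal vertex `0` and non-edges `12` and `34`. -/
def wheelGraph : SimpleGraph (Fin 5) where
  Adj i j := (![2, 0, 0, 1, 1] : Fin 5 → Fin 3) i ≠ (![2, 0, 0, 1, 1] : Fin 5 → Fin 3) j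
  symm := ⟨fun _ _ h => h.symm⟩
  loopless := ⟨fun _ h => h rfl⟩

instance : DecidableRel wheelGraph.Adj := fun _ _ => inferInstanceAs (Decidable (_ ≠ _))

/-- The labelling of the vertices of `K221` by `Fin 5`. -/
def wheelVertex : Fin 5 → Σ i : Fin 3, Fin (![2, 2, 1] i) :=
  ![⟨2, (0 : Fin 1)⟩, ⟨0, (0 : Fin 2)⟩, ⟨0, (1 : Fin 2)⟩, ⟨1, (0 : Fin 2)⟩, ⟨1, (1 : Fin 2)⟩]

theorem wheelVertex_bijective : Function.Bijective wheelVertex := by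
  rw [Fintype.bijective_iff_injective_and_card]
  exact ⟨by decide, by decide⟩

theorem nonempty_wheelGraph_iso : Nonempty (wheelGraph ≃g K221) :=
  ⟨{ toEquiv := Equiv.ofBijective wheelVertex wheelVertex_bijective
     map_rel_iff' := fun {a b} => by
      have h : ∀ a b, ((wheelVertex a).1 ≠ (wheelVertex b).1 ↔ wheelGraph.Adj a b) := by decide
      exact h a b }⟩

/-- Turns automorphisms into a decidable subtype of permutations, which can be counted by
evaluation. -/
theorem card_iso_self [Finite W] (H : SimpleGraph W) :
    Nat.card (H ≃g H) = Nat.card {σ : Equiv.Perm W // ∀ i j, H.Adj (σ i) (σ j) ↔ H.Adj i j} :=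
  Nat.card_congr
    { toFun := fun e => ⟨e.toEquiv, fun _ _ => e.map_rel_iff⟩
      invFun := fun σ => ⟨σ.1, fun {i j} => σ.2 i j⟩
      left_inv := fun _ => rfl
      right_inv := fun _ => rfl }

theorem card_wheelGraph_iso : Nat.card (wheelGraph ≃g wheelGraph) = 8 := by
  rw [card_iso_self, Nat.card_eq_fintype_card]
  decide +kernel

theorem card_top_iso : Nat.card ((⊤ : SimpleGraph (Fin 2)) ≃g (⊤ : SimpleGraph (Fin 2))) = 2 := by
  rw [card_iso_self, Nat.card_eq_fintype_card]
  decide +kernel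

theorem card_wheelGraph_embedding [Fintype V] (G : SimpleGraph V) :
    Nat.card (wheelGraph ↪g G) = 8 * inducedCount K221 G := by
  rw [card_embedding_eq, card_wheelGraph_iso, inducedCount_congr nonempty_wheelGraph_iso.some,
    mul_comm]

end Counting

/-! ### Boolean counts of a graph -/

section Adjacency

variable {V : Type*} (G : SimpleGraph V) [DecidableRel G.Adj]

/-- The adjacency relation of a graph with Boolean values. -/
def adjBool (u v : V) : Bool := decide (G.Adj u v)

theorem adjBool_comm (u v : V) : adjBool G u v = adjBool G v u := by
  simp only [adjBool, G.adj_comm]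

theorem adjBool_self (v : V) : adjBool G v v = false := by
  simp [adjBool]

theorem dartCount_adjBool [Fintype V] :
    dartCount (adjBool G) = 2 * inducedCount (⊤ : SimpleGraph (Fin 2)) G := by
  classical
  have h := card_embedding_eq (⊤ : SimpleGraph (Fin 2)) G
  rw [card_top_iso] at h
  have h2 : Nat.card ((⊤ : SimpleGraph (Fin 2)) ↪g G) = Nat.card {p : V × V // G.Adj p.1 p.2} :=
    Nat.card_congr
      { toFun := fun f => ⟨(f 0, f 1), f.map_rel_iff.mpr (by simp)⟩
        invFun := fun p => ⟨⟨![p.1.1, p.1.2], by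
            have := p.2.ne
            have := p.2.ne'
            intro i j hij
            fin_cases i <;> fin_cases j <;> simp_all⟩, by
            intro i j
            change G.Adj (![p.1.1, p.1.2] i) (![p.1.1, p.1.2] j) ↔ _
            fin_cases i <;> fin_cases j <;> simp [p.2, p.2.symm]⟩
        left_inv := fun f => by ext i; fin_cases i <;> rfl
        right_inv := fun p => rfl }
  have h3 : dartCount (adjBool G) = (Nat.card {p : V × V // G.Adj p.1 p.2} : ℤ) := by
    rw [Nat.card_eq_fintype_card, Fintype.card_subtype, Finset.card_filter, Nat.cast_sum,
      Fintype.sum_prod_type]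
    simp [dartCount, adjBool, Bool.cond_decide]
  rw [h3, ← h2, h]
  push_cast
  ring

/-- Only an inequality: `wheelCount` also admits maps that identify the two ends of a non-edge. -/
theorem le_wheelCount_adjBool [Fintype V] :
    8 * (inducedCount K221 G : ℤ) ≤ wheelCount (adjBool G) := by
  classical
  have h := card_wheelGraph_embedding G
  let P : (Fin 5 → V) → Prop := fun x =>
    wheelBool (adjBool G (x 0) (x 1)) (adjBool G (x 0) (x 2)) (adjBool G (x 0) (x 3))
      (adjBool G (x 0) (x 4)) (adjBool G (x 1) (x 2)) (adjBool G (x 1) (x 3))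
      (adjBool G (x 1) (x 4)) (adjBool G (x 2) (x 3)) (adjBool G (x 2) (x 4))
      (adjBool G (x 3) (x 4)) = true
  have h1 : wheelCount (adjBool G) = (Nat.card {x // P x} : ℤ) := by
    rw [Nat.card_eq_fintype_card, Fintype.card_subtype, Finset.card_filter, Nat.cast_sum]
    simp only [P, wheelCount, Nat.cast_ite, Nat.cast_one, Nat.cast_zero]
    rw [← sum_fin_five_fun]
    refine Finset.sum_congr rfl fun x _ => ?_
    rw [Bool.cond_eq_ite]
  have h2 : Nat.card (wheelGraph ↪g G) ≤ Nat.card {x // P x} := by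
    refine Nat.card_le_card_of_injective (fun f => ⟨f, ?_⟩) fun f g hfg => ?_
    · have hf : ∀ i j, adjBool G (f i) (f j) = decide (wheelGraph.Adj i j) := fun i j => by
        simp only [adjBool, f.map_rel_iff]
      simp only [P, hf]
      decide
    · exact DFunLike.coe_injective (congrArg Subtype.val hfg)
  rw [h1]
  exact_mod_cast h ▸ h2

end Adjacency

/-! ### Passage to the limit -/

theorem tendsto_pow_div_choose (k : ℕ) :
    Tendsto (fun n : ℕ => (n : ℝ) ^ k / (n.choose k : ℝ)) atTop (𝓝 (k.factorial : ℝ)) := by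
  have hk : (k.factorial : ℝ) ≠ 0 := by positivity
  have h := (Asymptotics.isEquivalent_iff_tendsto_one (by
    filter_upwards [eventually_gt_atTop 0] with n hn
    positivity)).mp (isEquivalent_choose k)
  have h' := (h.inv₀ one_ne_zero).mul_const (k.factorial : ℝ)
  rw [inv_one, one_mul] at h'
  refine h'.congr fun n => ?_
  simp only [Pi.div_apply, inv_div]
  field_simp

section

variable {G : ∀ n : ℕ, SimpleGraph (Fin n)} [∀ n, DecidableRel (G n).Adj]

theorem hasEdgeDensityLimit_iff {e : ℝ} : HasEdgeDensityLimit G e ↔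
    Tendsto (fun n => (dartCount (adjBool (G n)) : ℝ) / (n : ℝ) ^ 2) atTop (𝓝 e) := by
  have h2 := tendsto_pow_div_choose 2
  have h2' := h2.inv₀ (by norm_num)
  have hne : ∀ᶠ n : ℕ in atTop, (n : ℝ) ≠ 0 ∧ (n.choose 2 : ℝ) ≠ 0 := by
    filter_upwards [eventually_ge_atTop 2] with n hn
    have := Nat.choose_pos hn
    exact ⟨by positivity, by positivity⟩
  unfold HasEdgeDensityLimit
  constructor
  · intro h
    have := (h.mul h2').mul_const 2
    have he : e * ((Nat.factorial 2 : ℕ) : ℝ)⁻¹ * 2 = e := by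
      norm_num [Nat.factorial]
      ring
    rw [he] at this
    refine this.congr' ?_
    filter_upwards [hne] with n hn
    have hd : (dartCount (adjBool (G n)) : ℝ) = 2 * inducedCount (⊤ : SimpleGraph (Fin 2)) (G n) := by
      exact_mod_cast dartCount_adjBool (G n)
    obtain ⟨hn1, hn2⟩ := hn
    simp only [inducedDensity, Fintype.card_fin, hd]
    field_simp
  · intro h
    have := (h.mul h2).mul_const (1 / 2)
    have he : e * ((Nat.factorial 2 : ℕ) : ℝ) * (1 / 2) = e := by
      norm_num [Nat.factorial]
      ring
    rw [he] at this
    refine this.congr' ?_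
    filter_upwards [hne] with n hn
    have hd : (dartCount (adjBool (G n)) : ℝ) = 2 * inducedCount (⊤ : SimpleGraph (Fin 2)) (G n) := by
      exact_mod_cast dartCount_adjBool (G n)
    obtain ⟨hn1, hn2⟩ := hn
    simp only [inducedDensity, Fintype.card_fin, hd]
    field_simp

theorem inducedDensity_nonneg {W V : Type*} [Fintype W] [Fintype V] (H : SimpleGraph W)
    (G : SimpleGraph V) : 0 ≤ inducedDensity H G := by
  unfold inducedDensity
  positivity

theorem card_K221_vertices : Fintype.card (Σ i : Fin 3, Fin (![2, 2, 1] i)) = 5 := by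
  decide

theorem inducedDensity_K221_le {n : ℕ} {t : ℝ} (hn : 5 ≤ n)
    (h : (wheelCount (adjBool (G n)) : ℝ) ≤ t * (n : ℝ) ^ 5) :
    inducedDensity K221 (G n) ≤ t / 8 * ((n : ℝ) ^ 5 / (n.choose 5 : ℝ)) := by
  have h1 : (8 : ℝ) * inducedCount K221 (G n) ≤ wheelCount (adjBool (G n)) := by
    exact_mod_cast le_wheelCount_adjBool (G n)
  have := Nat.choose_pos hn
  rw [inducedDensity, card_K221_vertices, Fintype.card_fin, ← mul_div_assoc]
  gcongr
  linarith

/-- The factor is 15 = 5! / 8, there being 8 automorphisms. -/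
theorem limsup_inducedDensity_K221_le {t : ℕ → ℝ} {c : ℝ} (ht : Tendsto t atTop (𝓝 c))
    (h : ∀ᶠ n in atTop, (wheelCount (adjBool (G n)) : ℝ) ≤ t n * (n : ℝ) ^ 5) :
    limsup (fun n => inducedDensity K221 (G n)) atTop ≤ 15 * c := by
  have hu : Tendsto (fun n : ℕ => t n / 8 * ((n : ℝ) ^ 5 / (n.choose 5 : ℝ))) atTop
      (𝓝 (15 * c)) := by
    have := (ht.div_const 8).mul (tendsto_pow_div_choose 5)
    have hc : c / 8 * ((Nat.factorial 5 : ℕ) : ℝ) = 15 * c := by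
      norm_num [Nat.factorial]
      ring
    rwa [hc] at this
  rw [← hu.limsup_eq]
  refine limsup_le_limsup ?_ ?_ hu.isBoundedUnder_le
  · filter_upwards [h, eventually_ge_atTop 5] with n hn hn5
    exact inducedDensity_K221_le hn5 hn
  · exact isCoboundedUnder_le_of_le _ fun n => inducedDensity_nonneg _ _

theorem limsup_le_of_hasEdgeDensityLimit (hG : HasEdgeDensityLimit G 0.74) :
    limsup (fun n => inducedDensity K221 (G n)) atTop ≤ 44.94 / 128 := by
  rw [hasEdgeDensityLimit_iff] at hG
  set d : ℕ → ℝ := fun n => (dartCount (adjBool (G n)) : ℝ) / (n : ℝ) ^ 2 with hd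
  have ht : Tendsto (fun n => (315984 + 50940 * |50 * d n - 37|) / 13500000) atTop
      (𝓝 ((315984 + 50940 * |50 * (0.74 : ℝ) - 37|) / 13500000)) :=
    ((((hG.const_mul 50).sub_const 37).abs.const_mul 50940).const_add 315984).div_const _
  -- The absolute value vanishes at 0.74, leaving 15 · 315984 / 13500000 = 0.351093…, just below
  -- 44.94 / 128 = 0.35109375.
  refine (limsup_inducedDensity_K221_le ht ?_).trans (by norm_num)
  filter_upwards [eventually_gt_atTop 0] with n hn
  have h := wheelCount_le_of_dartCount (adjBool_comm (G n)) (adjBool_self (G n))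
  rw [Fintype.card_fin] at h
  have h' : 13500000 * (n : ℝ) * wheelCount (adjBool (G n)) ≤ 315984 * (n : ℝ) ^ 6 +
      50940 * (n : ℝ) ^ 4 * |50 * (dartCount (adjBool (G n)) : ℝ) - 37 * (n : ℝ) ^ 2| := by
    exact_mod_cast h
  have hn' : (0 : ℝ) < n := by exact_mod_cast hn
  have hdn : (dartCount (adjBool (G n)) : ℝ) = d n * (n : ℝ) ^ 2 := by
    simp only [hd]
    field_simp
  have habs : |50 * (d n * (n : ℝ) ^ 2) - 37 * (n : ℝ) ^ 2| = |50 * d n - 37| * (n : ℝ) ^ 2 := by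
    rw [← abs_of_pos (pow_pos hn' 2), ← abs_mul, abs_of_pos (pow_pos hn' 2)]
    congr 1
    ring
  rw [hdn, habs] at h'
  have h'' : (n : ℝ) * (13500000 * wheelCount (adjBool (G n))) ≤
      (n : ℝ) * ((315984 + 50940 * |50 * d n - 37|) * (n : ℝ) ^ 5) := by
    linarith
  have := le_of_mul_le_mul_left h'' hn'
  linarith

theorem limsup_le_of_hasEdgeDensityLimit_three_quarters (hG : HasEdgeDensityLimit G (3 / 4)) :
    limsup (fun n => inducedDensity K221 (G n)) atTop ≤ 45 / 128 := by
  rw [hasEdgeDensityLimit_iff] at hG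
  set d : ℕ → ℝ := fun n => (dartCount (adjBool (G n)) : ℝ) / (n : ℝ) ^ 2 with hd
  have ht : Tendsto (fun n => (135 - 120 * d n) / 1920) atTop
      (𝓝 ((135 - 120 * (3 / 4 : ℝ)) / 1920)) := ((hG.const_mul 120).const_sub 135).div_const _
  refine (limsup_inducedDensity_K221_le ht ?_).trans (by norm_num)
  filter_upwards [eventually_gt_atTop 0] with n hn
  have h := wheelCount_add_dartCount_le (adjBool_comm (G n))
  rw [Fintype.card_fin] at h
  have h' : 1920 * (wheelCount (adjBool (G n)) : ℝ) + 120 * (n : ℝ) ^ 3 *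
      (dartCount (adjBool (G n)) : ℝ) ≤ 135 * (n : ℝ) ^ 5 := by
    exact_mod_cast h
  have hn' : (0 : ℝ) < n := by exact_mod_cast hn
  have hdn : (dartCount (adjBool (G n)) : ℝ) = d n * (n : ℝ) ^ 2 := by
    simp only [hd]
    field_simp
  rw [hdn] at h'
  linarith

end

/-! ### Turán graphs and the lower bound 45/128 -/

theorem dartCount_adjBool_eq_card_edgeFinset {V : Type*} [Fintype V] (G : SimpleGraph V)
    [DecidableRel G.Adj] : dartCount (adjBool G) = 2 * (G.edgeFinset.card : ℤ) := by
  have h := G.sum_degrees_eq_twice_card_edges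
  have h' : dartCount (adjBool G) = ((∑ v, G.degree v : ℕ) : ℤ) := by
    push_cast
    refine Finset.sum_congr rfl fun v _ => ?_
    rw [← G.card_neighborFinset_eq_degree, G.neighborFinset_eq_filter, Finset.card_filter,
      Nat.cast_sum]
    simp [adjBool, Bool.cond_decide]
  rw [h', h]
  push_cast
  ring

/-- In the exact edge count the squared remainder costs at most 3 · 9 and the floor at most 7, while
the binomial term adds at most 8 · 3. -/
theorem abs_card_edgeFinset_turanGraph_four_sub_le (n : ℕ) :
    |8 * ((SimpleGraph.turanGraph n 4).edgeFinset.card : ℤ) - 3 * (n : ℤ) ^ 2| ≤ 35 := by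
  rw [SimpleGraph.card_edgeFinset_turanGraph]
  have h4 : n % 4 < 4 := Nat.mod_lt _ (by norm_num)
  have hle : (n % 4) ^ 2 ≤ n ^ 2 := Nat.pow_le_pow_left (Nat.mod_le _ _) 2
  have hsq : (n % 4) ^ 2 ≤ 9 := Nat.pow_le_pow_left (Nat.le_of_lt_succ h4) 2
  have hch : (n % 4).choose 2 ≤ 3 := by
    interval_cases n % 4 <;> decide
  have : (n : ℤ) ^ 2 = ((n ^ 2 : ℕ) : ℤ) := by push_cast; rfl
  rw [this, abs_le]
  generalize n ^ 2 = m at *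
  generalize (n % 4) ^ 2 = s at *
  generalize (n % 4).choose 2 = c at *
  omega

theorem hasEdgeDensityLimit_turanGraph :
    HasEdgeDensityLimit (fun n => SimpleGraph.turanGraph n 4) (3 / 4) := by
  rw [hasEdgeDensityLimit_iff, tendsto_iff_norm_sub_tendsto_zero]
  have h : Tendsto (fun n : ℕ => 35 / 4 / (n : ℝ) ^ 2) atTop (𝓝 0) :=
    tendsto_const_nhds.div_atTop
      ((tendsto_pow_atTop two_ne_zero).comp tendsto_natCast_atTop_atTop)
  refine squeeze_zero' (Eventually.of_forall fun n => norm_nonneg _) ?_ h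
  filter_upwards [eventually_gt_atTop 0] with n hn
  have hn' : (0 : ℝ) < n := by exact_mod_cast hn
  have h1 : |8 * ((SimpleGraph.turanGraph n 4).edgeFinset.card : ℝ) - 3 * (n : ℝ) ^ 2| ≤ 35 := by
    exact_mod_cast abs_card_edgeFinset_turanGraph_four_sub_le n
  rw [dartCount_adjBool_eq_card_edgeFinset, Real.norm_eq_abs]
  push_cast
  set E : ℝ := ((SimpleGraph.turanGraph n 4).edgeFinset.card : ℝ)
  have h2 : 2 * E / (n : ℝ) ^ 2 - 3 / 4 = (8 * E - 3 * (n : ℝ) ^ 2) / (4 * (n : ℝ) ^ 2) := by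
    field_simp
    ring
  rw [h2, abs_div, abs_of_pos (by positivity : 0 < 4 * (n : ℝ) ^ 2), div_div]
  gcongr

/-- Classes are residues mod 4. Assigning distinct residues to the three classes (24 ways) and
distinct quotients to the five vertices gives 24 · 5! · C(n/4, 5) embeddings, and 24 · 120 / 8 =
360. Requiring distinct quotients loses only lower-order terms. -/
theorem le_inducedCount_turanGraph (n : ℕ) :
    360 * (n / 4).choose 5 ≤ inducedCount K221 (SimpleGraph.turanGraph n 4) := by
  let p : Fin 5 → Fin 3 := ![2, 0, 0, 1, 1]
  have hp : Function.Surjective p := by decide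
  let Φ : (Fin 3 ↪ Fin 4) × (Fin 5 ↪ Fin (n / 4)) → (wheelGraph ↪g SimpleGraph.turanGraph n 4) :=
    fun x =>
      { toFun := fun i => ⟨4 * (x.2 i : ℕ) + (x.1 (p i) : ℕ), by
          have := (x.2 i).2
          have := (x.1 (p i)).2
          omega⟩
        inj' := fun i j h => by
          have h' := congrArg Fin.val h
          have := (x.1 (p i)).2
          have := (x.1 (p j)).2
          exact x.2.injective (Fin.ext (by simp only at h'; omega))
        map_rel_iff' := fun {i j} => by
          change (4 * (x.2 i : ℕ) + (x.1 (p i) : ℕ)) % 4 ≠ (4 * (x.2 j : ℕ) + (x.1 (p j) : ℕ)) % 4 ↔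
            p i ≠ p j
          rw [Nat.mul_add_mod, Nat.mul_add_mod, Nat.mod_eq_of_lt (x.1 (p i)).2,
            Nat.mod_eq_of_lt (x.1 (p j)).2, not_iff_not, Fin.val_inj, x.1.injective.eq_iff] }
  have hΦ : Function.Injective Φ := by
    rintro ⟨s, y⟩ ⟨s', y'⟩ h
    have h' : ∀ i, 4 * (y i : ℕ) + (s (p i) : ℕ) = 4 * (y' i : ℕ) + (s' (p i) : ℕ) := fun i =>
      congrArg Fin.val (DFunLike.congr_fun h i)
    refine Prod.ext (DFunLike.ext _ _ fun c => ?_) (DFunLike.ext _ _ fun i => ?_)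
    · obtain ⟨i, rfl⟩ := hp c
      have := h' i
      have := (s (p i)).2
      have := (s' (p i)).2
      exact Fin.ext (by simp only; omega)
    · have := h' i
      have := (s (p i)).2
      have := (s' (p i)).2
      exact Fin.ext (by simp only; omega)
  have h := Nat.card_le_card_of_injective Φ hΦ
  rw [card_wheelGraph_embedding, Nat.card_prod, Nat.card_eq_fintype_card,
    Nat.card_eq_fintype_card, Fintype.card_embedding_eq, Fintype.card_embedding_eq] at h
  simp only [Fintype.card_fin, Nat.descFactorial_eq_factorial_mul_choose (n / 4)] at h
  norm_num [Nat.descFactorial, Nat.factorial] at h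
  omega

theorem tendsto_choose_div_four :
    Tendsto (fun n : ℕ => (360 * (n / 4).choose 5 : ℝ) / (n.choose 5 : ℝ)) atTop
      (𝓝 (45 / 128)) := by
  have hq : Tendsto (fun n : ℕ => n / 4) atTop atTop :=
    Nat.tendsto_div_const_atTop (by norm_num)
  have h1 := ((tendsto_pow_div_choose 5).comp hq).inv₀ (by positivity)
  have h2 : Tendsto (fun n : ℕ => ((n / 4 : ℕ) : ℝ) / (n : ℝ)) atTop (𝓝 (1 / 4)) := by
    have h := (tendsto_nat_floor_mul_div_atTop (R := ℝ) (a := 1 / 4) (by norm_num)).comp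
      tendsto_natCast_atTop_atTop
    refine h.congr fun n => ?_
    simp only [Function.comp]
    congr 2
    rw [one_div_mul_eq_div]
    exact_mod_cast Nat.floor_div_eq_div (K := ℝ) n 4
  have h3 := ((h1.mul (h2.pow 5)).mul (tendsto_pow_div_choose 5)).const_mul 360
  have hc : 360 * ((((Nat.factorial 5 : ℕ) : ℝ)⁻¹ * (1 / 4) ^ 5) * ((Nat.factorial 5 : ℕ) : ℝ)) =
      45 / 128 := by
    norm_num [Nat.factorial]
  rw [hc] at h3
  refine h3.congr' ?_
  filter_upwards [eventually_ge_atTop 4] with n hn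
  have hn' : (n : ℝ) ≠ 0 := by
    have : n ≠ 0 := by omega
    exact_mod_cast this
  have hq' : ((n / 4 : ℕ) : ℝ) ≠ 0 := by
    have : n / 4 ≠ 0 := by omega
    exact_mod_cast this
  simp only [Function.comp, inv_div]
  field_simp

theorem inducedDensity_K221_turanGraph_ge (n : ℕ) :
    (360 * (n / 4).choose 5 : ℝ) / (n.choose 5 : ℝ) ≤
      inducedDensity K221 (SimpleGraph.turanGraph n 4) := by
  rw [inducedDensity, card_K221_vertices, Fintype.card_fin]
  gcongr
  exact_mod_cast le_inducedCount_turanGraph n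

theorem inducedCount_le_choose {W V : Type*} [Fintype W] [Fintype V] (H : SimpleGraph W)
    (G : SimpleGraph V) : inducedCount H G ≤ (Fintype.card V).choose (Fintype.card W) := by
  classical
  rw [inducedCount, ← Finset.card_univ (α := V), ← Finset.card_powersetCard, ← Set.ncard_coe_finset]
  refine Set.ncard_le_ncard_of_injOn (fun s => s.toFinset) ?_ ?_ (Finset.finite_toSet _)
  · rintro s ⟨e⟩
    simp only [Finset.mem_coe, Finset.mem_powersetCard_univ, Set.toFinset_card]
    exact Fintype.card_congr e.toEquiv
  · intro s _ t _ h
    exact Set.toFinset_inj.mp h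

/-- Supplies the boundedness needed to compare real limsups from below. -/
theorem inducedDensity_le_one {W V : Type*} [Fintype W] [Fintype V] (H : SimpleGraph W)
    (G : SimpleGraph V) : inducedDensity H G ≤ 1 :=
  div_le_one_of_le₀ (by exact_mod_cast inducedCount_le_choose H G) (by positivity)

theorem le_limsup_inducedDensity_turanGraph :
    45 / 128 ≤ limsup (fun n => inducedDensity K221 (SimpleGraph.turanGraph n 4)) atTop := by
  rw [← tendsto_choose_div_four.limsup_eq]
  exact limsup_le_limsup (Eventually.of_forall inducedDensity_K221_turanGraph_ge)
    tendsto_choose_div_four.isCoboundedUnder_le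
    (isBoundedUnder_of ⟨1, fun n => inducedDensity_le_one _ _⟩)

theorem maxInducedDensity_K221_three_quarters : maxInducedDensity K221 (3 / 4) = 45 / 128 := by
  classical
  have hub : ∀ y ∈ {y : ℝ | ∃ G : ∀ n : ℕ, SimpleGraph (Fin n), HasEdgeDensityLimit G (3 / 4) ∧
      y = limsup (fun n => inducedDensity K221 (G n)) atTop}, y ≤ 45 / 128 := by
    rintro y ⟨G, hG, rfl⟩
    exact limsup_le_of_hasEdgeDensityLimit_three_quarters hG
  exact le_antisymm (Real.sSup_le hub (by norm_num))
    (le_limsup_inducedDensity_turanGraph.trans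
      (le_csSup ⟨_, hub⟩ ⟨_, hasEdgeDensityLimit_turanGraph, rfl⟩))

theorem lemma3 :
    maxInducedDensity K221 0.74 ≤ 44.94 / 128 ∧
      44.94 / 128 < maxInducedDensity K221 (3 / 4) ∧
      maxInducedDensity K221 (3 / 4) = 45 / 128 := by
  classical
  -- Since the real supremum of the empty set is 0, a nonnegative bound suffices and no sequence of
  -- density 0.74 has to be exhibited.
  refine ⟨Real.sSup_le ?_ (by norm_num), ?_, maxInducedDensity_K221_three_quarters⟩
  · rintro y ⟨G, hG, rfl⟩
    exact limsup_le_of_hasEdgeDensityLimit hG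
  · rw [maxInducedDensity_K221_three_quarters]
    norm_num
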